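/- Let $n\ge 3$ and $d\ge 2$, and let $f\in\mathbf Z[x_1,\dots,x_n]$ be a homogeneous polynomial of degree $d$ with coprime coefficients such that the hypersurface $Z_f\subset\mathbf P^{n-1}$ defined by $f$ is smooth over $\mathbf C$. Let $S$ be the smallest set of primes such that $Z_f\subset\mathbf P^{n-1}_{\mathbf Z}$ is smooth over $\mathbf Z[S^{-1}]$; for $\mathbf a\in\mathbf Z^n$ let $S(\mathbf a)$ be the union of $S$ and the set of primes $p$ with $\mathbf a\in p\mathbf Z^n$. Let $H_{\mathbf a}\subset\mathbf P^{n-1}$ be the hyperplane $\langle\mathbf a,\mathbf x\rangle=0$ and $Z_{f,\mathbf a}=Z_f\cap H_{\mathbf a}$. A point of $Z_{f,\mathbf a}$ is called transverse if the gradients of $f$ and of $\langle\mathbf a,\mathbf x\rangle$ are linearly independent at that point; $Z^{t}_{f,\mathbf a}$ and $Z^{nt}_{f,\mathbf a}$ denote the loci of transverse and of non-transverse points of $Z_{f,\mathbf a}$. Then there is a constant $C$, depending only on $f$ (and so independent of $\mathbf a$ and $p$), such that for all $\mathbf a\in\mathbf Z^n$ and all primes $p\notin S(\mathbf a)$: 1.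 Over every field $K$ that is a $\mathbf Z_p$-algebra (in particular over $\mathbf F_p$ and over $\mathbf Q_p$), the locus $Z^{nt}_{f,\mathbf a}$ is the closed subscheme of $Z_{f,\mathbf a}$ defined by the homogeneous ideal generated by $f$, $\langle\mathbf a,\mathbf x\rangle$ and the $2\times2$ minors of their Jacobian matrix; it is either empty or of dimension $0$, and the degree of this subscheme of $\mathbf P^{n-1}_K$ is at most $C$. 2. $\# Z^{t}_{f,\mathbf a}(\mathbf F_p)\le C\,p^{n-3}$ and $\# Z^{nt}_{f,\mathbf a}(\mathbf F_p)\le C$. -/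

import Mathlib

open MvPolynomial

attribute [local instance] MvPolynomial.gradedAlgebra

namespace HyperplaneSection

/-- The hypersurface `F = 0` of `ℙ^{n-1}` over a field `K` is smooth (Jacobian criterion):
`F` and its partial derivatives have no common zero in `ℙ^{n-1}(K̄)`. -/
def IsSmoothHypersurface {n : ℕ} {K : Type*} [Field K] (F : MvPolynomial (Fin n) K) : Prop :=
  ∀ x : Fin n → AlgebraicClosure K, x ≠ 0 → aeval x F = 0 →
    ∃ i, aeval x (pderiv i F) ≠ 0

/-- The integral form `f`, viewed with coefficients in `K`. -/
noncomputable def formOver {n : ℕ} (K : Type*) [CommRing K] (f : MvPolynomial (Fin n) ℤ) :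
    MvPolynomial (Fin n) K :=
  map (Int.castRingHom K) f

/-- The integral vector `a`, viewed with coordinates in `K`. -/
def vecOver {n : ℕ} (K : Type*) [CommRing K] (a : Fin n → ℤ) : Fin n → K :=
  fun i => (a i : K)

/-- The coefficients of `f` are coprime. -/
def HasCoprimeCoeffs {n : ℕ} (f : MvPolynomial (Fin n) ℤ) : Prop :=
  ∀ c : ℤ, (∀ m, c ∣ f.coeff m) → IsUnit c

/-- The set `S` of primes of bad reduction. When `f` has coprime coefficients, `Z_f` is flat over
`ℤ`; if moreover its generic fibre is smooth, then this is the smallest set `S` of primes such that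
`Z_f` is smooth over `ℤ[S⁻¹]`. -/
def badPrimes {n : ℕ} (f : MvPolynomial (Fin n) ℤ) : Set ℕ :=
  {p | ∃ _ : Fact p.Prime, ¬ IsSmoothHypersurface (formOver (ZMod p) f)}

/-- The set `S(a)`: the bad primes together with the primes `p` such that `a ∈ pℤⁿ`. -/
def badPrimesAt {n : ℕ} (f : MvPolynomial (Fin n) ℤ) (a : Fin n → ℤ) : Set ℕ :=
  badPrimes f ∪ {p | p.Prime ∧ ∀ i, (p : ℤ) ∣ a i}

section Geometry

variable {n : ℕ} {K : Type*} [Field K]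

/-- The underlying space of the scheme `ℙ^{n-1}_K = Proj K[x_1, …, x_n]`. -/
abbrev ProjSpace (n : ℕ) (K : Type*) [Field K] : Type _ :=
  ProjectiveSpectrum (homogeneousSubmodule (Fin n) K)

/-- The linear form `⟨a, x⟩`, whose zero scheme is the hyperplane `H_a`. -/
noncomputable def linearForm (a : Fin n → K) : MvPolynomial (Fin n) K :=
  ∑ i, C (a i) * X i

/-- The points of the scheme `Z_{F,a} = Z_F ∩ H_a`. -/
def sectionLocus (F : MvPolynomial (Fin n) K) (a : Fin n → K) : Set (ProjSpace n K) :=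
  ProjectiveSpectrum.zeroLocus _ {F, linearForm a}

/-- The intersection of `Z_F` and `H_a` is transverse at the point `x` of `Z_F ∩ H_a`: the
gradients of the two equations are linearly independent at `x`. Here `x` is a homogeneous prime
`𝔭`; independence over the domain `K[x_1, …, x_n] ⧸ 𝔭` is the same as over its field of fractions,
an extension of the residue field at `x`. -/
def TransverseAt (F : MvPolynomial (Fin n) K) (a : Fin n → K) (x : ProjSpace n K) : Prop :=
  LinearIndependent (MvPolynomial (Fin n) K ⧸ x.asHomogeneousIdeal.toIdeal)
    ![fun i => Ideal.Quotient.mk x.asHomogeneousIdeal.toIdeal (pderiv i F),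
      fun i => Ideal.Quotient.mk x.asHomogeneousIdeal.toIdeal (pderiv i (linearForm a))]

/-- The points of `Z_{F,a}` at which the intersection is not transverse. -/
def nontransverseLocus (F : MvPolynomial (Fin n) K) (a : Fin n → K) : Set (ProjSpace n K) :=
  {x ∈ sectionLocus F a | ¬ TransverseAt F a x}

/-- The ideal defining `Z_{F,a}^{nt}` as a closed subscheme of `Z_{F,a}`: it is generated by the
equations of `Z_{F,a}` and by the `2 × 2` minors of their Jacobian matrix. -/
noncomputable def nontransverseIdeal (F : MvPolynomial (Fin n) K) (a : Fin n → K) :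
    Ideal (MvPolynomial (Fin n) K) :=
  Ideal.span ({F, linearForm a} ∪ Set.range fun ij : Fin n × Fin n =>
    pderiv ij.1 F * pderiv ij.2 (linearForm a) - pderiv ij.2 F * pderiv ij.1 (linearForm a))

/-- The Hilbert function `m ↦ dim_K (K[x_1, …, x_n] ⧸ I)_m`. -/
noncomputable def hilbertFunction (I : Ideal (MvPolynomial (Fin n) K)) (m : ℕ) : ℕ :=
  Module.finrank K
    ((homogeneousSubmodule (Fin n) K m).map (Ideal.Quotient.mkₐ K I).toLinearMap)

/-- `D` is the degree of the closed subscheme of `ℙ^{n-1}_K` defined by the homogeneous ideal `I`: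
`r!` times the leading coefficient of its Hilbert polynomial, of degree `r`. The empty scheme has
Hilbert polynomial `0` and degree `0`. -/
def HasDegree (I : Ideal (MvPolynomial (Fin n) K)) (D : ℕ) : Prop :=
  ∃ P : Polynomial ℚ, (∀ᶠ m : ℕ in Filter.atTop, P.eval (m : ℚ) = hilbertFunction I m) ∧
    (D : ℚ) = (P.natDegree.factorial : ℚ) * P.leadingCoeff

/-- The `K`-rational points of `Z_{F,a}`. -/
def sectionPoints (F : MvPolynomial (Fin n) K) (a : Fin n → K) :
    Set (Projectivization K (Fin n → K)) :=
  {P | eval P.rep F = 0 ∧ eval P.rep (linearForm a) = 0}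

/-- Transversality of `Z_F` and `H_a` at a `K`-rational point of `Z_F ∩ H_a`. -/
def TransverseAtPoint (F : MvPolynomial (Fin n) K) (a : Fin n → K)
    (P : Projectivization K (Fin n → K)) : Prop :=
  LinearIndependent K
    ![fun i => eval P.rep (pderiv i F), fun i => eval P.rep (pderiv i (linearForm a))]

/-- `Z_{F,a}^t(K)`. -/
def transversePoints (F : MvPolynomial (Fin n) K) (a : Fin n → K) :
    Set (Projectivization K (Fin n → K)) :=
  {P ∈ sectionPoints F a | TransverseAtPoint F a P}

/-- `Z_{F,a}^{nt}(K)`. -/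
def nontransversePoints (F : MvPolynomial (Fin n) K) (a : Fin n → K) :
    Set (Projectivization K (Fin n → K)) :=
  {P ∈ sectionPoints F a | ¬ TransverseAtPoint F a P}

end Geometry

end HyperplaneSection

/-!
Write `F` for the form over `K`, `I` for the ideal of the non-transverse locus, and choose `j` with
`a_j ≠ 0` in `K`. The minors in `I` make every partial derivative of `F` a multiple of `g = ∂_j F`
modulo `I`, so that `I + (g)` contains `F` and all its partial derivatives
(`jacobianIdeal_le_nontransverseIdeal_sup`). Since `Z_F` is smooth, the Nullstellensatz puts a power
`X_i ^ N` of every variable into `I + (g)`: the hypersurface `g = 0`, of degree `d - 1 ≥ 1`, misses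
the non-transverse locus, which therefore has dimension at most `0`. One exponent `N` serves for all
fibres of good reduction, because the relation over `ℚ` has a common denominator, divisible by only
finitely many primes (`exists_uniform_X_pow_mem`).

The rest is algebra of the graded ring `A = K[x] ⧸ I`. In degrees greater than `nN` multiplication
by `g` maps onto, so the Hilbert function is bounded by a number depending only on `n`, `N` and `d`
(`hilbertFunction_le_monomialCount`). This bound yields everything that concerns the non-transverse
locus.

* Homogeneous primes over `I` that do not contain all the variables are pairwise incomparable
  (`eq_of_le_of_X_pow_mem`), hence minimal over `I`. So the locus is finite with closed points, thus
  discrete, and has dimension `0` unless it is empty (`topologicalKrullDim_zeroLocus`).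
* The Hilbert function is eventually constant. Over a finite field a linear form missing the locus
  need not exist, but prime avoidance gives a form of degree `k(d - 1) + 1` missing it; the Hilbert
  function does not increase under steps of the two coprime lengths `d - 1` and `k(d - 1) + 1`, so it
  is eventually equal to its minimum, the degree of the locus (`exists_hasDegree_le`).
* Products of linear forms separate any `r` rational points in degree `r - 1`, so `r` is at most the
  value of the Hilbert function there (`card_le_hilbertFunction`).

For the transverse points, eliminate `x_j` from `F` by means of `⟨a, x⟩ = 0`. If the result is `0`,
then `⟨a, x⟩` divides `F` and there are no transverse points at all; otherwise the Schwartz–Zippel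
lemma bounds the number of its zeros (`ncard_transversePoints_le`).
-/

namespace HyperplaneSection

/-! ### Hilbert functions of graded quotients of the polynomial ring -/

section GradedIdeals

variable {n : ℕ} {K : Type*} [Field K]

/-- The graded piece `(K[x_1, …, x_n] ⧸ I)_m`, whose dimension is the Hilbert function. -/
noncomputable def quotientPiece (I : Ideal (MvPolynomial (Fin n) K)) (m : ℕ) :
    Submodule K (MvPolynomial (Fin n) K ⧸ I) :=
  (homogeneousSubmodule (Fin n) K m).map (Ideal.Quotient.mkₐ K I).toLinearMap

instance (m : ℕ) : FiniteDimensional K (homogeneousSubmodule (Fin n) K m) :=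
  Module.Finite.iff_fg.mpr (homogeneousSubmodule_fg _ _ m)

instance (I : Ideal (MvPolynomial (Fin n) K)) (m : ℕ) : FiniteDimensional K (quotientPiece I m) :=
  Module.Finite.map _ _

lemma hilbertFunction_eq (I : Ideal (MvPolynomial (Fin n) K)) (m : ℕ) :
    hilbertFunction I m = Module.finrank K (quotientPiece I m) := rfl

lemma homogeneousComponent_mul_left {g : MvPolynomial (Fin n) K} {e : ℕ} (hg : g.IsHomogeneous e)
    (v : MvPolynomial (Fin n) K) (m : ℕ) :
    homogeneousComponent (e + m) (g * v) = g * homogeneousComponent m v := by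
  have := DirectSum.coe_decompose_mul_add_of_left_mem (homogeneousSubmodule (Fin n) K)
    (a := g) (b := v) (i := e) (j := m) hg
  rwa [← decomposition.decompose'_apply, ← decomposition.decompose'_apply]

lemma exists_X_pow_mem_of_forall_mem_radical {A : Type*} [CommRing A]
    {J : Ideal (MvPolynomial (Fin n) A)} (h : ∀ i, X i ∈ J.radical) : ∃ N, ∀ i, X i ^ N ∈ J := by
  choose N hN using h
  exact ⟨∑ i, N i, fun i => Ideal.pow_mem_of_pow_mem _ (hN i)
    (Finset.single_le_sum (fun _ _ => Nat.zero_le _) (Finset.mem_univ i))⟩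

/-- Every monomial of degree greater than `nN` is divisible by some `X_i ^ N`. -/
lemma mem_of_isHomogeneous_of_X_pow_mem {J : Ideal (MvPolynomial (Fin n) K)} {N m : ℕ}
    (hJ : ∀ i, X i ^ N ∈ J) (hm : n * N < m) {r : MvPolynomial (Fin n) K}
    (hr : r.IsHomogeneous m) : r ∈ J := by
  rw [r.as_sum]
  refine J.sum_mem fun s hs => ?_
  have hdeg : s.degree = m := by
    by_contra h
    exact (mem_support_iff.1 hs) (hr.coeff_eq_zero h)
  obtain ⟨i, hi⟩ : ∃ i, N ≤ s i := by
    by_contra! h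
    have : s.degree ≤ n * N := by
      rw [Finsupp.degree_eq_sum]
      calc ∑ i, s i ≤ ∑ _i : Fin n, N := Finset.sum_le_sum fun i _ => (h i).le
        _ = n * N := by simp
    omega
  have : monomial s (coeff s r) =
      monomial (s - Finsupp.single i N) (coeff s r) * (X i ^ N : MvPolynomial (Fin n) K) := by
    rw [X_pow_eq_monomial, monomial_mul, mul_one, tsub_add_cancel_of_le]
    simpa using hi
  rw [this]
  exact J.mul_mem_left _ (hJ i)

/-- If `I + (g)` contains a power of every variable, then multiplication by `g` maps onto every
graded piece of `K[x] ⧸ I` of large degree. -/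
lemma quotientPiece_add_le {I : Ideal (MvPolynomial (Fin n) K)}
    (hI : I.IsHomogeneous (homogeneousSubmodule (Fin n) K)) {g : MvPolynomial (Fin n) K} {e : ℕ}
    (hg : g.IsHomogeneous e) {N m : ℕ} (hN : ∀ i, X i ^ N ∈ I ⊔ Ideal.span {g})
    (hm : n * N < m + e) :
    quotientPiece I (m + e) ≤
      (quotientPiece I m).map (LinearMap.mulLeft K (Ideal.Quotient.mk I g)) := by
  rintro _ ⟨r, hr, rfl⟩
  obtain ⟨u, hu, w, hw, huw⟩ := Submodule.mem_sup.1 (mem_of_isHomogeneous_of_X_pow_mem hN hm hr)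
  obtain ⟨v, rfl⟩ := Ideal.mem_span_singleton.1 hw
  have h1 : r = homogeneousComponent (e + m) u + g * homogeneousComponent m v := by
    rw [← homogeneousComponent_mul_left hg, ← map_add, huw, add_comm e m]
    exact (homogeneousComponent_eq_self hr).symm
  refine ⟨Ideal.Quotient.mk I (homogeneousComponent m v),
    ⟨_, homogeneousComponent_isHomogeneous m v, rfl⟩, ?_⟩
  change Ideal.Quotient.mk I g * Ideal.Quotient.mk I _ = Ideal.Quotient.mk I r
  rw [← map_mul, Ideal.Quotient.eq]
  have := I.neg_mem (homogeneousComponent_mem_of_mem hI hu (e + m))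
  convert this using 1
  rw [h1]
  ring

lemma hilbertFunction_add_le {I : Ideal (MvPolynomial (Fin n) K)}
    (hI : I.IsHomogeneous (homogeneousSubmodule (Fin n) K)) {g : MvPolynomial (Fin n) K} {e : ℕ}
    (hg : g.IsHomogeneous e) {N m : ℕ} (hN : ∀ i, X i ^ N ∈ I ⊔ Ideal.span {g})
    (hm : n * N < m + e) : hilbertFunction I (m + e) ≤ hilbertFunction I m :=
  (Submodule.finrank_mono (quotientPiece_add_le hI hg hN hm)).trans
    (Submodule.finrank_map_le _ _)

lemma hilbertFunction_le_card (I : Ideal (MvPolynomial (Fin n) K)) (m : ℕ) :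
    hilbertFunction I m ≤ (Finset.finsuppAntidiag (Finset.univ : Finset (Fin n)) m).card := by
  classical
  refine (Submodule.finrank_map_le _ _).trans ?_
  have hle : homogeneousSubmodule (Fin n) K m ≤ Submodule.span K
      (((Finset.finsuppAntidiag (Finset.univ : Finset (Fin n)) m).image
        fun s => (monomial s 1 : MvPolynomial (Fin n) K) : Finset _) :
          Set (MvPolynomial (Fin n) K)) := by
    intro r hr
    rw [r.as_sum]
    refine Submodule.sum_mem _ fun s hs => ?_
    have hdeg : s.degree = m := by
      by_contra h
      exact (mem_support_iff.1 hs) (IsHomogeneous.coeff_eq_zero hr h)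
    have : (monomial s (coeff s r) : MvPolynomial (Fin n) K) = coeff s r • monomial s 1 := by
      rw [smul_monomial, smul_eq_mul, mul_one]
    rw [this]
    refine Submodule.smul_mem _ _ (Submodule.subset_span ?_)
    simp only [Finset.coe_image, Set.mem_image, Finset.mem_coe, Finset.mem_finsuppAntidiag]
    exact ⟨s, ⟨by rw [← hdeg, Finsupp.degree_eq_sum], Finset.subset_univ _⟩, rfl⟩
  exact (Submodule.finrank_mono hle).trans ((finrank_span_finset_le_card _).trans
    Finset.card_image_le)

/-- The number of monomials of degree at most `M` in `n` variables. -/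
def monomialCount (n M : ℕ) : ℕ :=
  ∑ m ∈ Finset.range (M + 1), (Finset.finsuppAntidiag (Finset.univ : Finset (Fin n)) m).card

lemma hilbertFunction_le_monomialCount {I : Ideal (MvPolynomial (Fin n) K)}
    (hI : I.IsHomogeneous (homogeneousSubmodule (Fin n) K)) {g : MvPolynomial (Fin n) K} {e : ℕ}
    (he : 0 < e) (hg : g.IsHomogeneous e) {N : ℕ} (hN : ∀ i, X i ^ N ∈ I ⊔ Ideal.span {g})
    (m : ℕ) : hilbertFunction I m ≤ monomialCount n (n * N + e) := by
  induction m using Nat.strong_induction_on with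
  | _ m ih =>
    by_cases hm : m ≤ n * N + e
    · exact (hilbertFunction_le_card I m).trans
        (Finset.single_le_sum
          (f := fun m => (Finset.finsuppAntidiag (Finset.univ : Finset (Fin n)) m).card)
          (fun _ _ => Nat.zero_le _) (Finset.mem_range.2 (by omega)))
    · obtain ⟨k, rfl⟩ : ∃ k, m = k + e := ⟨m - e, by omega⟩
      exact (hilbertFunction_add_le hI hg hN (by omega)).trans (ih k (by omega))

/-- Multiplication by an element outside a prime ideal is injective on the graded
pieces of the quotient. -/
lemma finrank_map_quotientPiece {P : Ideal (MvPolynomial (Fin n) K)} (hP : P.IsPrime)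
    {φ : MvPolynomial (Fin n) K} (hφP : φ ∉ P) (m : ℕ) :
    Module.finrank K ((quotientPiece P m).map (LinearMap.mulLeft K (Ideal.Quotient.mk P φ))) =
      hilbertFunction P m := by
  have hinj : Function.Injective (LinearMap.mulLeft K (Ideal.Quotient.mk P φ)) := by
    have : Ideal.Quotient.mk P φ ≠ 0 := fun h => hφP (Ideal.Quotient.eq_zero_iff_mem.1 h)
    exact mul_right_injective₀ this
  exact (Submodule.equivMapOfInjective _ hinj _).finrank_eq.symm

lemma map_mulLeft_quotientPiece_le (I : Ideal (MvPolynomial (Fin n) K))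
    {φ : MvPolynomial (Fin n) K} {t : ℕ} (hφ : φ.IsHomogeneous t) (m : ℕ) :
    (quotientPiece I m).map (LinearMap.mulLeft K (Ideal.Quotient.mk I φ)) ≤
      quotientPiece I (m + t) := by
  rintro _ ⟨_, ⟨r, hr, rfl⟩, rfl⟩
  refine ⟨φ * r, ?_, ?_⟩
  · rw [add_comm m t]; exact hφ.mul hr
  · exact map_mul (Ideal.Quotient.mk I) _ _

lemma hilbertFunction_le_add {P : Ideal (MvPolynomial (Fin n) K)} (hP : P.IsPrime)
    {φ : MvPolynomial (Fin n) K} {t : ℕ} (hφ : φ.IsHomogeneous t) (hφP : φ ∉ P) (m : ℕ) :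
    hilbertFunction P m ≤ hilbertFunction P (m + t) := by
  rw [← finrank_map_quotientPiece hP hφP m]
  exact Submodule.finrank_mono (map_mulLeft_quotientPiece_le P hφ m)

/-- Homogeneous primes of a graded ring that is finite over `K[g]` and do not contain `g` are
pairwise incomparable: for `P ≤ Q` and a homogeneous `φ ∈ Q \ P`, the Hilbert function of `P` is
eventually periodic of period `e`, so multiplication by `φ ^ e` is onto in large degrees, and a
power of `g` is a multiple of `φ ^ e` modulo `P`, hence lies in `Q`. -/
lemma eq_of_le_of_X_pow_mem {P Q : Ideal (MvPolynomial (Fin n) K)} (hP : P.IsPrime)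
    (hQ : Q.IsPrime) (hPh : P.IsHomogeneous (homogeneousSubmodule (Fin n) K))
    (hQh : Q.IsHomogeneous (homogeneousSubmodule (Fin n) K)) (hPQ : P ≤ Q)
    {g : MvPolynomial (Fin n) K} {e : ℕ} (he : 0 < e) (hg : g.IsHomogeneous e) {N : ℕ}
    (hN : ∀ i, X i ^ N ∈ P ⊔ Ideal.span {g}) (hQX : ∃ i, X i ∉ Q) : P = Q := by
  have hgQ : g ∉ Q := by
    intro h
    obtain ⟨i, hi⟩ := hQX
    exact hi (hQ.mem_of_pow_mem _ (sup_le hPQ ((Ideal.span_singleton_le_iff_mem _).2 h) (hN i)))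
  have hgP : g ∉ P := fun h => hgQ (hPQ h)
  refine le_antisymm hPQ fun h hhQ => ?_
  rw [mem_iff_homogeneousComponent_mem hPh]
  intro t
  by_contra hφP
  have hφQ := homogeneousComponent_mem_of_mem hQh hhQ t
  have hφ := homogeneousComponent_isHomogeneous t h
  generalize homogeneousComponent t h = φ at hφP hφQ hφ
  have hstep : ∀ k, hilbertFunction P (e * (n * N + 1) + e * k) =
      hilbertFunction P (e * (n * N + 1)) := by
    intro k
    induction k with
    | zero => rfl
    | succ k ih =>
      rw [← ih, show e * (n * N + 1) + e * (k + 1) = e * (n * N + 1) + e * k + e by ring]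
      refine le_antisymm (hilbertFunction_add_le hPh hg hN ?_) (hilbertFunction_le_add hP hg hgP _)
      have := Nat.le_mul_of_pos_left (n * N + 1) he
      have := Nat.zero_le (e * k)
      linarith
  have hφe : φ ^ e ∉ P := fun h => hφP (hP.mem_of_pow_mem _ h)
  -- both degrees are multiples of `e`, so both pieces have the same dimension
  have heq := Submodule.eq_of_le_of_finrank_eq
    (map_mulLeft_quotientPiece_le P (hφ.pow e) (e * (n * N + 1))) (by
      rw [finrank_map_quotientPiece hP hφe, ← hilbertFunction_eq, mul_comm t e, hstep])
  have hgm : Ideal.Quotient.mk P (g ^ (n * N + 1 + t)) ∈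
      quotientPiece P (e * (n * N + 1) + t * e) := by
    rw [show e * (n * N + 1) + t * e = e * (n * N + 1 + t) by ring]
    exact ⟨_, hg.pow (n * N + 1 + t), rfl⟩
  rw [← heq] at hgm
  obtain ⟨_, ⟨r, -, rfl⟩, hr⟩ := hgm
  have hmem : φ ^ e * r - g ^ (n * N + 1 + t) ∈ P := by
    rw [← Ideal.Quotient.eq]
    exact (map_mul _ _ _).trans hr
  have : g ^ (n * N + 1 + t) ∈ Q := by
    have h1 : φ ^ e * r ∈ Q := Q.mul_mem_right _ (Q.pow_mem_of_mem hφQ e he)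
    have := Q.sub_mem h1 (hPQ hmem)
    simpa using this
  exact hgQ (hQ.mem_of_pow_mem _ this)

lemma isHomogeneous_of_mem_minimalPrimes {I P : Ideal (MvPolynomial (Fin n) K)}
    (hI : I.IsHomogeneous (homogeneousSubmodule (Fin n) K)) (hP : P ∈ I.minimalPrimes) :
    P.IsHomogeneous (homogeneousSubmodule (Fin n) K) := by
  have hprime := hP.1.1
  have hle := Ideal.toIdeal_homogeneousCore_le (homogeneousSubmodule (Fin n) K) P
  have h1 : I ≤ (P.homogeneousCore (homogeneousSubmodule (Fin n) K)).toIdeal := by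
    rw [← hI.toIdeal_homogeneousCore_eq_self]
    exact Ideal.homogeneousCore_mono _ hP.1.2
  have h2 := hP.2 ⟨hprime.homogeneousCore, h1⟩ hle
  rw [Ideal.IsHomogeneous.iff_eq]
  exact le_antisymm hle h2

end GradedIdeals

/-! ### Prime avoidance and the degree -/

section Degree

variable {n : ℕ} {K : Type*} [Field K]

/-- A function that does not increase under steps of the coprime lengths `e` and `ke + 1` is
eventually constant, with value its minimum. -/
lemma eventually_const_of_add_le {H : ℕ → ℕ} {e k M : ℕ} (he : 0 < e)
    (h1 : ∀ m, M ≤ m → H (m + e) ≤ H m) (h2 : ∀ m, M ≤ m → H (m + (k * e + 1)) ≤ H m) :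
    ∃ D, ∀ᶠ m in Filter.atTop, H m = D := by
  obtain ⟨m₀, hm₀, hmin⟩ : ∃ m₀, M ≤ m₀ ∧ ∀ m, M ≤ m → H m₀ ≤ H m := by
    have hne : (H '' Set.Ici M).Nonempty := ⟨H M, M, Set.self_mem_Ici, rfl⟩
    obtain ⟨m₀, hm₀, h⟩ := Nat.sInf_mem hne
    exact ⟨m₀, hm₀, fun m hm => h ▸ Nat.sInf_le ⟨m, hm, rfl⟩⟩
  have h1' : ∀ a m, M ≤ m → H (m + a * e) ≤ H m := by
    intro a m hm
    induction a with
    | zero => simp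
    | succ a ih =>
      rw [show m + (a + 1) * e = m + a * e + e by ring]
      exact (h1 _ (by omega)).trans ih
  have h2' : ∀ b m, M ≤ m → H (m + b * (k * e + 1)) ≤ H m := by
    intro b m hm
    induction b with
    | zero => simp
    | succ b ih =>
      rw [show m + (b + 1) * (k * e + 1) = m + b * (k * e + 1) + (k * e + 1) by ring]
      exact (h2 _ (by omega)).trans ih
  refine ⟨H m₀, Filter.eventually_atTop.2 ⟨m₀ + e * (e * k), fun m hm => ?_⟩⟩
  refine le_antisymm ?_ (hmin m (by omega))
  obtain ⟨j, rfl⟩ : ∃ j, m = m₀ + j := ⟨m - m₀, by omega⟩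
  -- `j = qe + b` with `b < e ≤ q`, so `j = (q - bk)e + b(ke + 1)`
  have hj := Nat.div_add_mod j e
  have hb : j % e < e := Nat.mod_lt _ he
  have hq : e * k ≤ j / e := by
    rw [Nat.le_div_iff_mul_le he]
    linarith
  have hbk : j % e * k ≤ j / e := (Nat.mul_le_mul_right k hb.le).trans hq
  obtain ⟨a, ha⟩ := Nat.exists_eq_add_of_le hbk
  have : m₀ + j = m₀ + a * e + j % e * (k * e + 1) := by
    conv_lhs => rw [← hj, ha]
    ring
  rw [this]
  exact (h2' _ _ (by omega)).trans (h1' _ _ hm₀)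

/-- Homogeneous prime avoidance with control of the degree modulo `e`. For each `P`, a product of
elements of the other primes is raised to the power `e` and multiplied by a variable outside `P`;
the powers of `g` equalize the degrees of the summands. -/
lemma exists_isHomogeneous_forall_notMem (S : Finset (Ideal (MvPolynomial (Fin n) K)))
    (hprime : ∀ P ∈ S, P.IsPrime)
    (hhom : ∀ P ∈ S, P.IsHomogeneous (homogeneousSubmodule (Fin n) K))
    (hinc : ∀ P ∈ S, ∀ Q ∈ S, Q ≤ P → Q = P) {g : MvPolynomial (Fin n) K} {e : ℕ} (he : 0 < e)
    (hg : g.IsHomogeneous e) (hgS : ∀ P ∈ S, g ∉ P) (hX : ∀ P ∈ S, ∃ i, X i ∉ P) :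
    ∃ (k : ℕ) (h : MvPolynomial (Fin n) K), h.IsHomogeneous (k * e + 1) ∧ ∀ P ∈ S, h ∉ P := by
  classical
  have hsep : ∀ P ∈ S, ∃ (t : ℕ) (y : MvPolynomial (Fin n) K), y.IsHomogeneous (t * e + 1) ∧
      y ∉ P ∧ ∀ Q ∈ S, Q ≠ P → y ∈ Q := by
    intro P hP
    have hPp := hprime P hP
    have hex : ∀ Q : Ideal (MvPolynomial (Fin n) K), ∃ (t : ℕ) (y : MvPolynomial (Fin n) K),
        y.IsHomogeneous t ∧ y ∉ P ∧ (Q ∈ S → Q ≠ P → y ∈ Q) := by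
      intro Q
      by_cases hQ : Q ∈ S ∧ Q ≠ P
      · obtain ⟨y, hyQ, hyP⟩ := SetLike.not_le_iff_exists.1 fun h => hQ.2 (hinc P hP Q hQ.1 h)
        rw [mem_iff_homogeneousComponent_mem (hhom P hP)] at hyP
        push Not at hyP
        obtain ⟨t, ht⟩ := hyP
        exact ⟨t, _, homogeneousComponent_isHomogeneous t y, ht, fun _ _ =>
          homogeneousComponent_mem_of_mem (hhom Q hQ.1) hyQ t⟩
      · exact ⟨0, 1, isHomogeneous_one _ _, fun h => hPp.ne_top ((Ideal.eq_top_iff_one P).2 h),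
          fun h1 h2 => absurd ⟨h1, h2⟩ hQ⟩
    choose t y hy hyP hyQ using hex
    obtain ⟨i, hi⟩ := hX P hP
    refine ⟨∑ Q ∈ S.erase P, t Q, (∏ Q ∈ S.erase P, y Q) ^ e * X i, ?_, ?_, ?_⟩
    · exact ((IsHomogeneous.prod _ _ _ fun Q _ => hy Q).pow e).mul (isHomogeneous_X _ i)
    · intro h
      rcases hPp.mem_or_mem h with h | h
      · obtain ⟨Q, -, hQ⟩ := (hPp.prod_mem_iff).1 (hPp.mem_of_pow_mem _ h)
        exact hyP Q hQ
      · exact hi h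
    · intro Q hQ hne
      refine Q.mul_mem_right _ (Q.pow_mem_of_mem ?_ e he)
      exact Ideal.mem_of_dvd _ (Finset.dvd_prod_of_mem y (Finset.mem_erase.2 ⟨hne, hQ⟩))
        (hyQ Q hQ hne)
  choose! t y hy hyP hyQ using hsep
  refine ⟨∑ P ∈ S, t P, ∑ P ∈ S, y P * g ^ (∑ P ∈ S, t P - t P), ?_, ?_⟩
  · refine IsHomogeneous.sum _ _ _ fun P hP => ?_
    have hle : t P ≤ ∑ P ∈ S, t P := Finset.single_le_sum (fun _ _ => Nat.zero_le _) hP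
    have := (hy P hP).mul (hg.pow (∑ P ∈ S, t P - t P))
    obtain ⟨c, hc⟩ := Nat.exists_eq_add_of_le hle
    rw [hc] at this ⊢
    rw [show (t P + c) * e + 1 = t P * e + 1 + e * (t P + c - t P) by
      rw [Nat.add_sub_cancel_left]; ring]
    exact this
  · intro P hP h
    have hPp := hprime P hP
    rw [← Finset.add_sum_erase _ _ hP, Ideal.add_mem_iff_left] at h
    · rcases hPp.mem_or_mem h with h | h
      · exact hyP P hP h
      · exact hgS P hP (hPp.mem_of_pow_mem _ h)
    · refine P.sum_mem fun Q hQ => P.mul_mem_right _ ?_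
      obtain ⟨hne, hQS⟩ := Finset.mem_erase.1 hQ
      exact hyQ Q hQS P hP hne.symm

/-- Every point of the projective scheme defined by `I` is the generic point of a component. -/
lemma mem_minimalPrimes_of_le {I Q : Ideal (MvPolynomial (Fin n) K)}
    (hI : I.IsHomogeneous (homogeneousSubmodule (Fin n) K)) {g : MvPolynomial (Fin n) K} {e : ℕ}
    (he : 0 < e) (hg : g.IsHomogeneous e) {N : ℕ} (hN : ∀ i, X i ^ N ∈ I ⊔ Ideal.span {g})
    (hQ : Q.IsPrime) (hQh : Q.IsHomogeneous (homogeneousSubmodule (Fin n) K)) (hIQ : I ≤ Q)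
    (hQX : ∃ i, X i ∉ Q) : Q ∈ I.minimalPrimes := by
  obtain ⟨P, hP, hPQ⟩ := Ideal.exists_minimalPrimes_le hIQ
  have := eq_of_le_of_X_pow_mem hP.1.1 hQ (isHomogeneous_of_mem_minimalPrimes hI hP) hQh hPQ he hg
    (fun i => sup_le_sup_right hP.1.2 _ (hN i)) hQX
  exact this ▸ hP

/-- There is a second form with the property assumed of `g`, of degree prime to `e`. It is chosen
outside the minimal primes of `I` that correspond to points of projective space. -/
lemma exists_isHomogeneous_X_pow_mem {I : Ideal (MvPolynomial (Fin n) K)}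
    (hI : I.IsHomogeneous (homogeneousSubmodule (Fin n) K)) {g : MvPolynomial (Fin n) K} {e : ℕ}
    (he : 0 < e) (hg : g.IsHomogeneous e) {N : ℕ} (hN : ∀ i, X i ^ N ∈ I ⊔ Ideal.span {g}) :
    ∃ (k : ℕ) (h : MvPolynomial (Fin n) K) (N' : ℕ), h.IsHomogeneous (k * e + 1) ∧
      ∀ i, X i ^ N' ∈ I ⊔ Ideal.span {h} := by
  classical
  have hfin : {P ∈ I.minimalPrimes | ∃ i, (X i : MvPolynomial (Fin n) K) ∉ P}.Finite :=
    (Ideal.finite_minimalPrimes_of_isNoetherianRing _ I).subset (Set.sep_subset _ _)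
  have hmem : ∀ P ∈ hfin.toFinset, P ∈ I.minimalPrimes ∧ ∃ i, X i ∉ P := fun P hP => by
    simpa using hP
  obtain ⟨k, h, hh, hhS⟩ := exists_isHomogeneous_forall_notMem hfin.toFinset
    (fun P hP => (hmem P hP).1.1.1)
    (fun P hP => isHomogeneous_of_mem_minimalPrimes hI (hmem P hP).1)
    (fun P hP Q hQ hle => le_antisymm hle ((hmem P hP).1.2 (hmem Q hQ).1.1 hle)) he hg
    (fun P hP hgP => by
      obtain ⟨hPm, i, hi⟩ := hmem P hP
      exact hi (hPm.1.1.mem_of_pow_mem _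
        (sup_le hPm.1.2 ((Ideal.span_singleton_le_iff_mem _).2 hgP) (hN i))))
    (fun P hP => (hmem P hP).2)
  have hJ : (I ⊔ Ideal.span {h}).IsHomogeneous (homogeneousSubmodule (Fin n) K) :=
    hI.sup (Ideal.homogeneous_span _ _ fun x hx => ⟨_, (Set.mem_singleton_iff.1 hx) ▸ hh⟩)
  have hrad : ∀ i, (X i : MvPolynomial (Fin n) K) ∈ (I ⊔ Ideal.span {h}).radical := by
    intro i
    rw [← Ideal.sInf_minimalPrimes, Ideal.mem_sInf]
    intro Q hQ
    by_contra hi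
    have hQm := mem_minimalPrimes_of_le hI he hg hN hQ.1.1
      (isHomogeneous_of_mem_minimalPrimes hJ hQ) (le_sup_left.trans hQ.1.2) ⟨i, hi⟩
    refine hhS Q (by simpa using ⟨hQm, i, hi⟩) ?_
    exact hQ.1.2 (Ideal.mem_sup_right (Ideal.mem_span_singleton_self h))
  obtain ⟨N', hN'⟩ := exists_X_pow_mem_of_forall_mem_radical hrad
  exact ⟨k, h, N', hh, hN'⟩

lemma hasDegree_of_eventually_eq {I : Ideal (MvPolynomial (Fin n) K)} {D : ℕ}
    (h : ∀ᶠ m in Filter.atTop, hilbertFunction I m = D) : HasDegree I D :=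
  ⟨Polynomial.C (D : ℚ), h.mono fun m hm => by simp [hm],
    by rw [Polynomial.natDegree_C, Polynomial.leadingCoeff_C]; simp⟩

/-- A scheme cut out by `I` and missed by the hypersurface `g = 0` has a degree, at most the
bound of the Hilbert function. -/
lemma exists_hasDegree_le {I : Ideal (MvPolynomial (Fin n) K)}
    (hI : I.IsHomogeneous (homogeneousSubmodule (Fin n) K)) {g : MvPolynomial (Fin n) K} {e : ℕ}
    (he : 0 < e) (hg : g.IsHomogeneous e) {N : ℕ} (hN : ∀ i, X i ^ N ∈ I ⊔ Ideal.span {g}) :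
    ∃ D, HasDegree I D ∧ D ≤ monomialCount n (n * N + e) := by
  obtain ⟨k, h, N', hh, hN'⟩ := exists_isHomogeneous_X_pow_mem hI he hg hN
  obtain ⟨D, hD⟩ := eventually_const_of_add_le (H := hilbertFunction I) (k := k)
    (M := n * N + n * N') he (fun m hm => hilbertFunction_add_le hI hg hN (by omega))
    (fun m hm => hilbertFunction_add_le hI hh hN' (by omega))
  refine ⟨D, hasDegree_of_eventually_eq hD, ?_⟩
  obtain ⟨m, hm⟩ := hD.exists
  exact hm ▸ hilbertFunction_le_monomialCount hI he hg hN m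

end Degree

/-! ### Dimension of the zero locus -/

section Dimension

variable {n : ℕ} {K : Type*} [Field K]

lemma exists_X_notMem (x : ProjSpace n K) : ∃ i, X i ∉ x.asHomogeneousIdeal.toIdeal := by
  by_contra! h
  refine x.not_irrelevant_le ?_
  rw [HomogeneousIdeal.irrelevant_le]
  intro m hm r hr
  -- `r ^ (n + 1)` has degree `m (n + 1) > n`, so each of its monomials contains a variable
  refine x.isPrime.mem_of_pow_mem (n + 1) (mem_of_isHomogeneous_of_X_pow_mem (N := 1)
    (fun i => by simpa using h i) ?_ (IsHomogeneous.pow hr (n + 1)))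
  nlinarith

lemma finite_zeroLocus {I : Ideal (MvPolynomial (Fin n) K)}
    (hI : I.IsHomogeneous (homogeneousSubmodule (Fin n) K)) {g : MvPolynomial (Fin n) K} {e : ℕ}
    (he : 0 < e) (hg : g.IsHomogeneous e) {N : ℕ} (hN : ∀ i, X i ^ N ∈ I ⊔ Ideal.span {g}) :
    (ProjectiveSpectrum.zeroLocus (homogeneousSubmodule (Fin n) K)
      (I : Set (MvPolynomial (Fin n) K))).Finite := by
  refine Set.Finite.of_finite_image (f := fun x => x.asHomogeneousIdeal.toIdeal)
    ((Ideal.finite_minimalPrimes_of_isNoetherianRing _ I).subset ?_) ?_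
  · rintro _ ⟨x, hx, rfl⟩
    exact mem_minimalPrimes_of_le hI he hg hN x.isPrime x.asHomogeneousIdeal.isHomogeneous hx
      (exists_X_notMem x)
  · intro x _ y _ h
    exact ProjectiveSpectrum.ext (HomogeneousIdeal.toIdeal_injective h)

/-- The zero locus is a finite `T₁` space, hence discrete. -/
lemma topologicalKrullDim_zeroLocus {I : Ideal (MvPolynomial (Fin n) K)}
    (hI : I.IsHomogeneous (homogeneousSubmodule (Fin n) K)) {g : MvPolynomial (Fin n) K} {e : ℕ}
    (he : 0 < e) (hg : g.IsHomogeneous e) {N : ℕ} (hN : ∀ i, X i ^ N ∈ I ⊔ Ideal.span {g})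
    (hne : (ProjectiveSpectrum.zeroLocus (homogeneousSubmodule (Fin n) K)
      (I : Set (MvPolynomial (Fin n) K))).Nonempty) :
    topologicalKrullDim (ProjectiveSpectrum.zeroLocus (homogeneousSubmodule (Fin n) K)
      (I : Set (MvPolynomial (Fin n) K))) = 0 := by
  set T := ProjectiveSpectrum.zeroLocus (homogeneousSubmodule (Fin n) K)
      (I : Set (MvPolynomial (Fin n) K)) with hT
  have hfin : Finite T := finite_zeroLocus hI he hg hN
  have hmin : ∀ x ∈ T, x.asHomogeneousIdeal.toIdeal ∈ I.minimalPrimes := fun x hx =>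
    mem_minimalPrimes_of_le hI he hg hN x.isPrime x.asHomogeneousIdeal.isHomogeneous hx
      (exists_X_notMem x)
  have hT1 : T1Space T := by
    refine ⟨fun x => ?_⟩
    rw [← closure_subset_iff_isClosed]
    intro y hy
    rw [closure_subtype, Set.image_singleton, ← ProjectiveSpectrum.le_iff_mem_closure] at hy
    have h1 : y.1.asHomogeneousIdeal.toIdeal ≤ x.1.asHomogeneousIdeal.toIdeal :=
      (hmin y y.2).2 (hmin x x.2).1 hy
    exact Subtype.ext (le_antisymm h1 hy)
  have : Nonempty T := hne.to_subtype
  refine le_antisymm (topologicalKrullDim_zero_of_discreteTopology T) ?_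
  have : Nonempty (TopologicalSpace.IrreducibleCloseds T) :=
    ⟨⟨{Classical.arbitrary T}, isIrreducible_singleton, isClosed_singleton⟩⟩
  exact Order.krullDim_nonneg

end Dimension

/-! ### Interpolation at rational points -/

section Points

variable {n : ℕ} {K : Type*} [Field K]

/-- Evaluation at representatives of distinct points of projective space is onto on forms of degree
one less than the number of points: products of linear forms interpolate. -/
lemma card_le_hilbertFunction {I : Ideal (MvPolynomial (Fin n) K)}
    (S : Finset (Projectivization K (Fin n → K))) (hS : ∀ P ∈ S, ∀ r ∈ I, eval P.rep r = 0) :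
    S.card ≤ hilbertFunction I (S.card - 1) := by
  classical
  have hlin : ∀ P Q : Projectivization K (Fin n → K), ∃ ℓ : MvPolynomial (Fin n) K,
      ℓ.IsHomogeneous 1 ∧ (Q ≠ P → eval Q.rep ℓ = 0 ∧ eval P.rep ℓ ≠ 0) := by
    intro P Q
    by_cases h : ∃ i j, Q.rep i * P.rep j - Q.rep j * P.rep i ≠ 0
    · obtain ⟨i, j, hij⟩ := h
      refine ⟨C (Q.rep i) * X j - C (Q.rep j) * X i,
        (isHomogeneous_C_mul_X _ _).sub (isHomogeneous_C_mul_X _ _), fun _ => ⟨?_, ?_⟩⟩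
      · simp [mul_comm]
      · simpa using hij
    · push Not at h
      refine ⟨0, isHomogeneous_zero _ _ _, fun hne => absurd ?_ hne⟩
      obtain ⟨i, hi⟩ := Function.ne_iff.1 Q.rep_nonzero
      rw [← P.mk_rep, ← Q.mk_rep]
      refine ((Projectivization.mk_eq_mk_iff' K _ _ P.rep_nonzero Q.rep_nonzero).2
        ⟨P.rep i / Q.rep i, ?_⟩).symm
      ext j
      have hi' : Q.rep i ≠ 0 := hi
      have := h i j
      simp only [Pi.smul_apply, smul_eq_mul]
      field_simp
      linear_combination -this
  choose ℓ hℓ hℓe using hlin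
  let v : S → quotientPiece I (S.card - 1) := fun P =>
    ⟨Ideal.Quotient.mk I (∏ Q ∈ S.erase P, ℓ P Q), _, by
      have := IsHomogeneous.prod (S.erase P) (ℓ P) (fun _ => 1) fun Q _ => hℓ P Q
      simpa [Finset.card_erase_of_mem P.2] using this, rfl⟩
  have hv : LinearIndependent K v := by
    rw [Fintype.linearIndependent_iff]
    intro c hc P
    have h0 : ∑ Q : S, C (c Q) * ∏ R ∈ S.erase Q, ℓ Q R ∈ I := by
      rw [← Ideal.Quotient.eq_zero_iff_mem, map_sum]
      have h := congrArg Subtype.val hc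
      rw [Submodule.coe_sum] at h
      refine Eq.trans (Finset.sum_congr rfl fun Q _ => ?_) h
      rw [map_mul]
      exact (Algebra.smul_def (c Q) (Ideal.Quotient.mk I (∏ R ∈ S.erase Q, ℓ Q R))).symm
    have h1 := hS P P.2 _ h0
    rw [map_sum, Finset.sum_eq_single P] at h1
    · rw [map_mul, eval_C, map_prod, mul_eq_zero, Finset.prod_eq_zero_iff] at h1
      refine h1.resolve_right ?_
      rintro ⟨Q, hQ, h⟩
      exact (hℓe P Q (Finset.mem_erase.1 hQ).1).2 h
    · intro Q _ hQ
      have : P.1 ∈ S.erase Q := Finset.mem_erase.2 ⟨fun h => hQ (Subtype.ext h.symm), P.2⟩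
      rw [map_mul, map_prod, Finset.prod_eq_zero this, mul_zero]
      exact (hℓe Q P (Finset.mem_erase.1 this).1).1
    · simp
  simpa [hilbertFunction_eq] using hv.fintype_card_le_finrank

end Points

/-! ### Uniform Nullstellensatz for the singular locus -/

section Jacobian

variable {n : ℕ}

/-- The ideal generated by a form and its partial derivatives, which defines the singular locus. -/
noncomputable def jacobianIdeal {A : Type*} [CommRing A] (F : MvPolynomial (Fin n) A) :
    Ideal (MvPolynomial (Fin n) A) :=
  Ideal.span (insert F (Set.range fun i => pderiv i F))

lemma map_jacobianIdeal {A B : Type*} [CommRing A] [CommRing B] (φ : A →+* B)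
    (F : MvPolynomial (Fin n) A) :
    (jacobianIdeal F).map (map φ) = jacobianIdeal (map φ F) := by
  rw [jacobianIdeal, Ideal.map_span, Set.image_insert_eq, ← Set.range_comp]
  simp only [jacobianIdeal, Function.comp_def, pderiv_map]

/-- The Nullstellensatz for the singular locus. The base field `k` of the form may be smaller than
the field `L` over which the hypersurface is known to be smooth. -/
lemma X_mem_radical_jacobianIdeal {k L : Type*} [Field k] [Field L] [Algebra k L]
    {F : MvPolynomial (Fin n) k} (hF : IsSmoothHypersurface (map (algebraMap k L) F)) (i : Fin n) :
    X i ∈ (jacobianIdeal F).radical := by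
  rw [← vanishingIdeal_zeroLocus_eq_radical (K := AlgebraicClosure L), mem_vanishingIdeal_iff]
  intro x hx
  by_contra hne
  have hx0 : x ≠ 0 := by
    rintro rfl
    simp at hne
  obtain ⟨j, hj⟩ := hF x hx0 (by
    rw [aeval_map_algebraMap]
    exact hx _ (Ideal.subset_span (Set.mem_insert _ _)))
  rw [pderiv_map, aeval_map_algebraMap] at hj
  exact hj (hx _ (Ideal.subset_span (Set.mem_insert_of_mem _ ⟨j, rfl⟩)))

lemma map_formOver {A B : Type*} [CommRing A] [CommRing B] (φ : A →+* B)
    (f : MvPolynomial (Fin n) ℤ) : map φ (formOver A f) = formOver B f := by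
  rw [formOver, map_map, formOver]
  exact congrArg (fun ψ => map ψ f) (RingHom.ext_int (φ.comp (Int.castRingHom A)) _)

lemma X_pow_mem_jacobianIdeal_formOver {A B : Type*} [CommRing A] [CommRing B] (φ : A →+* B)
    {f : MvPolynomial (Fin n) ℤ} {N : ℕ} {i : Fin n}
    (h : X i ^ N ∈ jacobianIdeal (formOver A f)) : X i ^ N ∈ jacobianIdeal (formOver B f) := by
  have := Ideal.mem_map_of_mem (map φ) h
  rwa [map_jacobianIdeal, map_formOver, map_pow, map_X] at this

attribute [local instance] algebraMvPolynomial in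
/-- Clearing denominators in the Nullstellensatz over `ℚ`. -/
lemma exists_int_mul_X_pow_mem {f : MvPolynomial (Fin n) ℤ}
    (hsmooth : IsSmoothHypersurface (formOver ℂ f)) :
    ∃ (N : ℕ) (c : ℤ), c ≠ 0 ∧ ∀ i, C c * X i ^ N ∈ jacobianIdeal f := by
  have hQ : ∀ i, X i ∈ (jacobianIdeal (formOver ℚ f)).radical := fun i =>
    X_mem_radical_jacobianIdeal (L := ℂ) (by rwa [map_formOver]) i
  obtain ⟨N, hN⟩ := exists_X_pow_mem_of_forall_mem_radical hQ
  have hc : ∀ i : Fin n, ∃ c : ℤ, c ≠ 0 ∧ C c * X i ^ N ∈ jacobianIdeal f := by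
    intro i
    have h := hN i
    have hmap : jacobianIdeal (formOver ℚ f) =
        (jacobianIdeal f).map (algebraMap (MvPolynomial (Fin n) ℤ) (MvPolynomial (Fin n) ℚ)) := by
      rw [formOver, ← map_jacobianIdeal]
      rfl
    rw [hmap, IsLocalization.mem_map_algebraMap_iff
      ((nonZeroDivisors ℤ).map (C : ℤ →+* MvPolynomial (Fin n) ℤ))] at h
    obtain ⟨⟨⟨b, hb⟩, ⟨_, c, hc, rfl⟩⟩, h⟩ := h
    refine ⟨c, nonZeroDivisors.ne_zero hc, ?_⟩
    have hinj : Function.Injective (map (σ := Fin n) (Int.castRingHom ℚ)) :=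
      map_injective _ Int.cast_injective
    have : C c * X i ^ N = b := by
      apply hinj
      refine Eq.trans ?_ h
      rw [map_mul, map_pow, map_X, mul_comm]
      rfl
    rwa [this]
  choose c hc0 hc using hc
  refine ⟨N, ∏ i, c i, Finset.prod_ne_zero_iff.2 fun i _ => hc0 i, fun i => ?_⟩
  rw [← Finset.prod_erase_mul _ _ (Finset.mem_univ i), map_mul, mul_assoc]
  exact Ideal.mul_mem_left _ _ (hc i)

/-- One exponent serves for all fibres of good reduction: the exponent over `ℚ` also works modulo
all but finitely many primes. -/
lemma exists_uniform_X_pow_mem {f : MvPolynomial (Fin n) ℤ}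
    (hsmooth : IsSmoothHypersurface (formOver ℂ f)) :
    ∃ N : ℕ, ∀ (p : ℕ) [Fact p.Prime], p ∉ badPrimes f → ∀ (K : Type) [Field K],
      (CharZero K ∨ CharP K p) → ∀ i, X i ^ N ∈ jacobianIdeal (formOver K f) := by
  classical
  obtain ⟨N₀, c, hc, hN₀⟩ := exists_int_mul_X_pow_mem hsmooth
  have hp : ∀ p : ℕ, ∃ N : ℕ, p.Prime → p ∉ badPrimes f →
      ∀ i, X i ^ N ∈ jacobianIdeal (formOver (ZMod p) f) := by
    intro p
    by_cases h : p.Prime ∧ p ∉ badPrimes f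
    · have : Fact p.Prime := ⟨h.1⟩
      have hs : IsSmoothHypersurface (formOver (ZMod p) f) := by
        by_contra hs
        exact h.2 ⟨this, hs⟩
      obtain ⟨N, hN⟩ := exists_X_pow_mem_of_forall_mem_radical fun i =>
        X_mem_radical_jacobianIdeal (k := ZMod p) (L := ZMod p) (F := formOver (ZMod p) f)
          (by rwa [map_formOver]) i
      exact ⟨N, fun _ _ => hN⟩
    · exact ⟨0, fun h1 h2 => absurd ⟨h1, h2⟩ h⟩
  choose N hN using hp
  refine ⟨N₀ + ∑ p ∈ c.natAbs.primeFactors, N p, fun p hpp hgood K _ hK i => ?_⟩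
  have hle : ∀ {M : ℕ}, X i ^ M ∈ jacobianIdeal (formOver K f) →
      M ≤ N₀ + ∑ p ∈ c.natAbs.primeFactors, N p →
      X i ^ (N₀ + ∑ p ∈ c.natAbs.primeFactors, N p) ∈ jacobianIdeal (formOver K f) :=
    fun h hM => Ideal.pow_mem_of_pow_mem _ h hM
  by_cases hcK : (c : K) = 0
  · have hchar : CharP K p := by
      rcases hK with hK | hK
      · exact absurd (Int.cast_eq_zero.1 hcK) hc
      · exact hK
    have hdvd : p ∣ c.natAbs := by
      rw [← Int.natCast_dvd]
      exact (CharP.intCast_eq_zero_iff K p c).1 hcK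
    refine hle (X_pow_mem_jacobianIdeal_formOver (ZMod.castHom dvd_rfl K)
      (hN p hpp.out hgood i)) (le_add_left ?_)
    exact Finset.single_le_sum (fun _ _ => Nat.zero_le _)
      (Nat.mem_primeFactors.2 ⟨hpp.out, hdvd, Int.natAbs_ne_zero.2 hc⟩)
  · refine hle (M := N₀) ?_ (Nat.le_add_right _ _)
    have h := Ideal.mem_map_of_mem (map (Int.castRingHom K)) (hN₀ i)
    rw [map_jacobianIdeal, map_mul, map_pow, map_X, map_C] at h
    have := Ideal.mul_mem_left _ (C (c : K)⁻¹) h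
    rwa [← mul_assoc, ← C_mul, eq_intCast, inv_mul_cancel₀ hcK, C_1, one_mul] at this

end Jacobian

/-! ### The ideal of the non-transverse locus -/

section Nontransverse

variable {n : ℕ} {K : Type*} [Field K]

lemma isHomogeneous_linearForm (a : Fin n → K) : (linearForm a).IsHomogeneous 1 :=
  IsHomogeneous.sum _ _ _ fun _ _ => isHomogeneous_C_mul_X _ _

lemma pderiv_linearForm (a : Fin n → K) (i : Fin n) : pderiv i (linearForm a) = C (a i) := by
  classical
  simp only [linearForm, map_sum, pderiv_C_mul, pderiv_X]
  rw [Finset.sum_eq_single i]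
  · simp
  · intro j _ hj
    simp [hj]
  · simp

/-- Two vectors over a domain are linearly independent if and only if some `2 × 2` minor is not
zero. -/
lemma linearIndependent_pair_iff_exists_minor_ne_zero {A ι : Type*} [CommRing A] [IsDomain A]
    (u v : ι → A) : LinearIndependent A ![u, v] ↔ ∃ i j, u i * v j - u j * v i ≠ 0 := by
  rw [LinearIndependent.pair_iff]
  constructor
  · intro h
    by_contra! hm
    obtain ⟨j, hj⟩ : ∃ j, v j ≠ 0 := by
      by_contra! hv
      have := h 0 1 (by ext i; simp [hv i])
      exact one_ne_zero this.2
    refine hj (h (v j) (-u j) ?_).1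
    ext i
    simp only [Pi.add_apply, Pi.smul_apply, smul_eq_mul, Pi.zero_apply]
    linear_combination hm i j
  · rintro ⟨i, j, hij⟩ s t hst
    have hi := congrFun hst i
    have hj := congrFun hst j
    simp only [Pi.add_apply, Pi.smul_apply, smul_eq_mul, Pi.zero_apply] at hi hj
    constructor
    · refine (mul_eq_zero.1 (?_ : s * (u i * v j - u j * v i) = 0)).resolve_right hij
      linear_combination v j * hi - v i * hj
    · refine (mul_eq_zero.1 (?_ : t * (u i * v j - u j * v i) = 0)).resolve_right hij
      linear_combination u i * hj - u j * hi

lemma nontransverseIdeal_isHomogeneous {F : MvPolynomial (Fin n) K} {d : ℕ}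
    (hF : F.IsHomogeneous d) (a : Fin n → K) :
    (nontransverseIdeal F a).IsHomogeneous (homogeneousSubmodule (Fin n) K) := by
  refine Ideal.homogeneous_span _ _ ?_
  rintro _ ((rfl | rfl) | ⟨ij, rfl⟩)
  · exact ⟨d, hF⟩
  · exact ⟨1, isHomogeneous_linearForm a⟩
  · exact ⟨d - 1 + (1 - 1), (hF.pderiv.mul (isHomogeneous_linearForm a).pderiv).sub
      (hF.pderiv.mul (isHomogeneous_linearForm a).pderiv)⟩

lemma nontransverseLocus_eq_zeroLocus (F : MvPolynomial (Fin n) K) (a : Fin n → K) :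
    nontransverseLocus F a = ProjectiveSpectrum.zeroLocus (homogeneousSubmodule (Fin n) K)
      (nontransverseIdeal F a : Set (MvPolynomial (Fin n) K)) := by
  rw [nontransverseIdeal, ProjectiveSpectrum.zeroLocus_span, ProjectiveSpectrum.zeroLocus_union]
  ext x
  refine and_congr Iff.rfl ?_
  rw [TransverseAt, linearIndependent_pair_iff_exists_minor_ne_zero]
  push Not
  rw [ProjectiveSpectrum.mem_zeroLocus, Set.range_subset_iff]
  simp only [Prod.forall, ← map_mul, ← map_sub, Ideal.Quotient.eq_zero_iff_mem]
  rfl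

lemma eval_eq_zero_of_mem_nontransverseIdeal {F : MvPolynomial (Fin n) K} {a : Fin n → K}
    {P : Projectivization K (Fin n → K)} (hP : P ∈ nontransversePoints F a)
    {r : MvPolynomial (Fin n) K} (hr : r ∈ nontransverseIdeal F a) : eval P.rep r = 0 := by
  obtain ⟨⟨h1, h2⟩, h3⟩ := hP
  rw [TransverseAtPoint, linearIndependent_pair_iff_exists_minor_ne_zero] at h3
  push Not at h3
  have : nontransverseIdeal F a ≤ RingHom.ker (eval P.rep) := by
    refine Ideal.span_le.2 ?_
    rintro _ ((rfl | rfl) | ⟨ij, rfl⟩)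
    · exact h1
    · exact h2
    · simpa using h3 ij.1 ij.2
  exact this hr

/-- Where `a_j ≠ 0`, the vanishing of the minors makes every partial derivative a multiple of
`∂_j F`. -/
lemma jacobianIdeal_le_nontransverseIdeal_sup (F : MvPolynomial (Fin n) K) {a : Fin n → K}
    {j : Fin n} (hj : a j ≠ 0) :
    jacobianIdeal F ≤ nontransverseIdeal F a ⊔ Ideal.span {pderiv j F} := by
  refine Ideal.span_le.2 ?_
  rintro _ (rfl | ⟨i, rfl⟩)
  · exact Ideal.mem_sup_left (Ideal.subset_span (Or.inl (Or.inl rfl)))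
  · have hminor : pderiv i F * C (a j) - pderiv j F * C (a i) ∈ nontransverseIdeal F a := by
      rw [← pderiv_linearForm, ← pderiv_linearForm]
      exact Ideal.subset_span (Or.inr ⟨(i, j), rfl⟩)
    have hg : C (a i) * pderiv j F ∈ Ideal.span {pderiv j F} :=
      Ideal.mul_mem_left _ _ (Ideal.mem_span_singleton_self _)
    have h := Ideal.mul_mem_left _ (C (a j)⁻¹) (Submodule.add_mem_sup hminor hg)
    have hC : (C (a j)⁻¹ * C (a j) : MvPolynomial (Fin n) K) = 1 := by
      rw [← C_mul, inv_mul_cancel₀ hj, C_1]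
    have heq : C (a j)⁻¹ * (pderiv i F * C (a j) - pderiv j F * C (a i) + C (a i) * pderiv j F) =
        pderiv i F := by
      linear_combination (pderiv i F) * hC
    rwa [heq] at h

lemma ncard_nontransversePoints_le {F : MvPolynomial (Fin n) K} {a : Fin n → K} {B : ℕ}
    (hB : ∀ m, hilbertFunction (nontransverseIdeal F a) m ≤ B) :
    (nontransversePoints F a).ncard ≤ B := by
  by_cases hfin : (nontransversePoints F a).Finite
  · rw [Set.ncard_eq_toFinset_card _ hfin]
    exact (card_le_hilbertFunction _ fun P hP r hr =>
      eval_eq_zero_of_mem_nontransverseIdeal (by simpa using hP) hr).trans (hB _)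
  · rw [Set.Infinite.ncard hfin]
    exact Nat.zero_le _

end Nontransverse

/-! ### Counting transverse points -/

section Transverse

variable {n : ℕ} {K : Type*} [Field K]

lemma eval_smul_of_isHomogeneous {F : MvPolynomial (Fin n) K} {d : ℕ} (hF : F.IsHomogeneous d)
    (c : K) (x : Fin n → K) : eval (c • x) F = c ^ d * eval x F := by
  rw [eval_eq', eval_eq', Finset.mul_sum]
  refine Finset.sum_congr rfl fun s hs => ?_
  have hdeg : s.degree = d := by
    by_contra h
    exact (mem_support_iff.1 hs) (hF.coeff_eq_zero h)
  simp only [Pi.smul_apply, smul_eq_mul, mul_pow, Finset.prod_mul_distrib,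
    Finset.prod_pow_eq_pow_sum]
  rw [← Finsupp.degree_eq_sum, hdeg]
  ring

/-- The projection of affine space onto the hyperplane `⟨a, x⟩ = 0` along the `j`-th coordinate
axis. -/
noncomputable def hyperplaneProj (a : Fin n → K) (j : Fin n) (y : Fin n → K) : Fin n → K :=
  Function.update y j (-∑ k ∈ Finset.univ.erase j, a k / a j * y k)

/-- The pullback of a form under `hyperplaneProj`. -/
noncomputable def hyperplanePullback (a : Fin n → K) (j : Fin n) :
    MvPolynomial (Fin n) K →ₐ[K] MvPolynomial (Fin n) K :=
  aeval (Function.update X j (-∑ k ∈ Finset.univ.erase j, C (a k / a j) * X k))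

lemma eval_hyperplanePullback (a : Fin n → K) (j : Fin n) (y : Fin n → K)
    (F : MvPolynomial (Fin n) K) :
    eval y (hyperplanePullback a j F) = eval (hyperplaneProj a j y) F := by
  have : (aeval y : _ →ₐ[K] K).comp (hyperplanePullback a j) = aeval (hyperplaneProj a j y) := by
    ext i
    by_cases hi : i = j
    · subst hi
      simp [hyperplanePullback, hyperplaneProj]
    · simp [hyperplanePullback, hyperplaneProj, hi]
  exact DFunLike.congr_fun this F

lemma hyperplaneProj_update {a : Fin n → K} {j : Fin n} (hj : a j ≠ 0) {x : Fin n → K}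
    (hx : eval x (linearForm a) = 0) (t : K) :
    hyperplaneProj a j (Function.update x j t) = x := by
  have hx' : ∑ k, a k * x k = 0 := by simpa [linearForm] using hx
  rw [← Finset.add_sum_erase _ _ (Finset.mem_univ j)] at hx'
  have hsum : ∑ k ∈ Finset.univ.erase j, a k / a j * Function.update x j t k =
      (∑ k ∈ Finset.univ.erase j, a k * x k) / a j := by
    rw [Finset.sum_div]
    refine Finset.sum_congr rfl fun k hk => ?_
    rw [Function.update_of_ne (Finset.mem_erase.1 hk).1]
    ring
  rw [hyperplaneProj, hsum, Function.update_idem, Function.update_eq_iff]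
  refine ⟨?_, fun _ _ => rfl⟩
  field_simp
  linear_combination -hx'

lemma isHomogeneous_hyperplanePullback (a : Fin n → K) (j : Fin n) {F : MvPolynomial (Fin n) K}
    {d : ℕ} (hF : F.IsHomogeneous d) : (hyperplanePullback a j F).IsHomogeneous d := by
  have := hF.aeval (Function.update X j
    (-∑ k ∈ Finset.univ.erase j, C (a k / a j) * (X k : MvPolynomial (Fin n) K))) (n := 1) ?_
  · rwa [one_mul] at this
  · intro i
    by_cases hi : i = j
    · subst hi
      rw [Function.update_self]
      exact (IsHomogeneous.sum _ _ _ fun k _ => isHomogeneous_C_mul_X _ k).neg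
    · simpa [hi] using isHomogeneous_X _ i

lemma linearForm_dvd_of_hyperplanePullback_eq_zero {a : Fin n → K} {j : Fin n} (hj : a j ≠ 0)
    {F : MvPolynomial (Fin n) K} (h : hyperplanePullback a j F = 0) : linearForm a ∣ F := by
  rw [← Ideal.mem_span_singleton, ← Ideal.Quotient.eq_zero_iff_mem]
  have hmk : (Ideal.Quotient.mkₐ K (Ideal.span {linearForm a})).comp (hyperplanePullback a j) =
      Ideal.Quotient.mkₐ K (Ideal.span {linearForm a}) := by
    ext i
    by_cases hi : i = j
    · subst hi
      simp only [hyperplanePullback, AlgHom.comp_apply, aeval_X, Function.update_self,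
        Ideal.Quotient.mkₐ_eq_mk]
      rw [Ideal.Quotient.eq]
      have hC : (C (a i)⁻¹ * C (a i) : MvPolynomial (Fin n) K) = 1 := by
        rw [← C_mul, inv_mul_cancel₀ hj, C_1]
      have hl := Ideal.mul_mem_left _ (-C (a i)⁻¹) (Ideal.mem_span_singleton_self (linearForm a))
      convert hl using 1
      rw [linearForm, ← Finset.add_sum_erase _ _ (Finset.mem_univ i), mul_add, Finset.mul_sum]
      have : ∑ k ∈ Finset.univ.erase i, C (a k / a i) * (X k : MvPolynomial (Fin n) K) =
          ∑ k ∈ Finset.univ.erase i, C (a i)⁻¹ * (C (a k) * X k) := by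
        refine Finset.sum_congr rfl fun k _ => ?_
        rw [← mul_assoc, ← C_mul, div_eq_inv_mul]
      rw [this]
      simp only [neg_mul, Finset.sum_neg_distrib]
      linear_combination X i * hC
    · simp [hyperplanePullback, hi]
  have := DFunLike.congr_fun hmk F
  rw [AlgHom.comp_apply, h, map_zero] at this
  exact this.symm

/-- If the hyperplane is a component of `Z_F`, it meets `Z_F` transversely nowhere. -/
lemma transversePoints_eq_empty_of_dvd {F : MvPolynomial (Fin n) K} {a : Fin n → K}
    (h : linearForm a ∣ F) : transversePoints F a = ∅ := by
  obtain ⟨Q, rfl⟩ := h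
  refine Set.eq_empty_iff_forall_notMem.2 ?_
  rintro P ⟨⟨-, h2⟩, h3⟩
  rw [TransverseAtPoint, linearIndependent_pair_iff_exists_minor_ne_zero] at h3
  obtain ⟨i, j, hij⟩ := h3
  refine hij ?_
  simp only [Derivation.leibniz, pderiv_linearForm, smul_eq_mul, map_add, map_mul, eval_C, h2]
  ring

lemma card_zeros_le [Fintype K] [DecidableEq K] {G : MvPolynomial (Fin n) K} {d : ℕ} (hG : G ≠ 0)
    (hd : G.IsHomogeneous d) (hn : 1 ≤ n) :
    Nat.card {y : Fin n → K // eval y G = 0} ≤ d * Fintype.card K ^ (n - 1) := by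
  have h := schwartz_zippel_totalDegree hG (Finset.univ : Finset K)
  have hq : (0 : ℚ≥0) < Fintype.card K := by exact_mod_cast Fintype.card_pos
  rw [Finset.card_univ, Fintype.piFinset_univ, div_le_div_iff₀ (by positivity) hq] at h
  have hcard : Nat.card {y : Fin n → K // eval y G = 0} =
      (Finset.univ.filter fun y : Fin n → K => eval y G = 0).card := by
    rw [Nat.card_eq_fintype_card, Fintype.card_subtype]
  rw [hcard]
  have h' : (Finset.univ.filter fun y : Fin n → K => eval y G = 0).card * Fintype.card K ≤
      G.totalDegree * Fintype.card K ^ n := by exact_mod_cast h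
  refine Nat.le_of_mul_le_mul_right (h'.trans ?_) (Fintype.card_pos (α := K))
  rw [mul_assoc, ← pow_succ, Nat.sub_add_cancel hn]
  exact Nat.mul_le_mul_right _ hd.totalDegree_le

/-- Each point of `Z_{F,a}(𝔽_q)` has `q - 1` affine representatives, and each of these has `q`
preimages under `hyperplaneProj`, all of them zeros of the pullback of `F`. -/
lemma ncard_sectionPoints_mul_le [Fintype K] [DecidableEq K] {F : MvPolynomial (Fin n) K} {d : ℕ}
    (hF : F.IsHomogeneous d) {a : Fin n → K} {j : Fin n} (hj : a j ≠ 0) :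
    (sectionPoints F a).ncard * ((Fintype.card K - 1) * Fintype.card K) ≤
      Nat.card {y : Fin n → K // eval y (hyperplanePullback a j F) = 0} := by
  have hline : ∀ (P : sectionPoints F a) (u : Kˣ),
      eval ((u : K) • P.1.rep) (linearForm a) = 0 := fun P u => by
    rw [eval_smul_of_isHomogeneous (isHomogeneous_linearForm a), P.2.2, mul_zero]
  have hproj : ∀ (P : sectionPoints F a) (u : Kˣ) (t : K),
      hyperplaneProj a j (Function.update ((u : K) • P.1.rep) j t) = (u : K) • P.1.rep :=
    fun P u t => hyperplaneProj_update hj (hline P u) t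
  let φ : sectionPoints F a × Kˣ × K →
      {y : Fin n → K // eval y (hyperplanePullback a j F) = 0} := fun x =>
    ⟨Function.update ((x.2.1 : K) • x.1.1.rep) j x.2.2, by
      rw [eval_hyperplanePullback, hproj, eval_smul_of_isHomogeneous hF, x.1.2.1, mul_zero]⟩
  have hφ : Function.Injective φ := by
    rintro ⟨P, u, t⟩ ⟨P', u', t'⟩ h
    have h0 : Function.update ((u : K) • P.1.rep) j t = Function.update ((u' : K) • P'.1.rep) j t' :=
      congrArg Subtype.val h
    have ht : t = t' := by simpa using congrFun h0 j
    have h1 : (u : K) • P.1.rep = (u' : K) • P'.1.rep := by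
      rw [← hproj P u t, h0, hproj]
    have hP : P = P' := by
      refine Subtype.ext ?_
      rw [← P.1.mk_rep, ← P'.1.mk_rep, Projectivization.mk_eq_mk_iff]
      refine ⟨u⁻¹ * u', ?_⟩
      rw [mul_smul, inv_smul_eq_iff]
      exact h1.symm
    subst hP
    have hu : u = u' := Units.ext (smul_left_injective K P.1.rep_nonzero h1)
    rw [ht, hu]
  have := Nat.card_le_card_of_injective φ hφ
  rwa [Nat.card_prod, Nat.card_prod, Nat.card_coe_set_eq, Nat.card_eq_fintype_card,
    Fintype.card_units, Nat.card_eq_fintype_card (α := K)] at this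

lemma ncard_transversePoints_le [Fintype K] {F : MvPolynomial (Fin n) K} {d : ℕ}
    (hF : F.IsHomogeneous d) {a : Fin n → K} {j : Fin n} (hj : a j ≠ 0) (hn : 3 ≤ n) :
    (transversePoints F a).ncard ≤ 2 * d * Fintype.card K ^ (n - 3) := by
  classical
  by_cases hG : hyperplanePullback a j F = 0
  · rw [transversePoints_eq_empty_of_dvd (linearForm_dvd_of_hyperplanePullback_eq_zero hj hG)]
    simp
  have h := (ncard_sectionPoints_mul_le hF hj).trans
    (card_zeros_le hG (isHomogeneous_hyperplanePullback a j hF) (by omega))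
  have hfin : Finite (Projectivization K (Fin n → K)) := inferInstance
  have hsub : (transversePoints F a).ncard ≤ (sectionPoints F a).ncard :=
    Set.ncard_le_ncard (Set.sep_subset _ _) (Set.toFinite _)
  have hq : 1 < Fintype.card K := Fintype.one_lt_card
  obtain ⟨k, rfl⟩ : ∃ k, n = k + 3 := ⟨n - 3, by omega⟩
  generalize Fintype.card K = q at *
  rw [show k + 3 - 1 = k + 2 by omega] at h
  rw [show k + 3 - 3 = k by omega]
  refine hsub.trans (Nat.le_of_mul_le_mul_right ?_ (show 0 < q * q by positivity))
  obtain ⟨r, rfl⟩ : ∃ r, q = r + 2 := ⟨q - 2, by omega⟩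
  rw [show r + 2 - 1 = r + 1 by omega] at h
  calc (sectionPoints F a).ncard * ((r + 2) * (r + 2))
      ≤ (sectionPoints F a).ncard * (2 * ((r + 1) * (r + 2))) :=
        Nat.mul_le_mul_left _ (by nlinarith)
    _ = 2 * ((sectionPoints F a).ncard * ((r + 1) * (r + 2))) := by ring
    _ ≤ 2 * (d * (r + 2) ^ (k + 2)) := Nat.mul_le_mul_left _ h
    _ = 2 * d * (r + 2) ^ k * ((r + 2) * (r + 2)) := by ring

end Transverse

/-! ### Fibres over the `p`-adic integers -/

lemma charZero_or_charP_of_padicInt_algebra (p : ℕ) [Fact p.Prime] (K : Type*) [Field K]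
    [Algebra ℤ_[p] K] : CharZero K ∨ CharP K p := by
  obtain ⟨q, hq⟩ := CharP.exists K
  rcases CharP.char_is_prime_or_zero K q with hq' | rfl
  · right
    by_cases hpq : p = q
    · rwa [hpq]
    · have hu : IsUnit (q : ℤ_[p]) := by
        rw [PadicInt.isUnit_iff, PadicInt.norm_natCast_eq_one_iff]
        exact (Nat.coprime_primes Fact.out hq').2 hpq
      have := hu.map (algebraMap ℤ_[p] K)
      rw [map_natCast, CharP.cast_eq_zero] at this
      exact absurd this not_isUnit_zero
  · exact Or.inl (CharP.charP_to_charZero K)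

end HyperplaneSection

theorem mainTheorem7 (n d : ℕ) (hn : 3 ≤ n) (hd : 2 ≤ d) (f : MvPolynomial (Fin n) ℤ)
    (hf : f.IsHomogeneous d) (hcoprime : HyperplaneSection.HasCoprimeCoeffs f)
    (hsmooth : HyperplaneSection.IsSmoothHypersurface (HyperplaneSection.formOver ℂ f)) :
    ∃ C : ℕ, ∀ (a : Fin n → ℤ) (p : ℕ) [Fact p.Prime],
      p ∉ HyperplaneSection.badPrimesAt f a →
      -- every fibre of the scheme over `ℤ_p`, in particular over `𝔽_p` and `ℚ_p`
      (∀ (K : Type) [Field K] [Algebra ℤ_[p] K],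
        (HyperplaneSection.nontransverseIdeal (HyperplaneSection.formOver K f)
            (HyperplaneSection.vecOver K a)).IsHomogeneous
          (MvPolynomial.homogeneousSubmodule (Fin n) K) ∧
        HyperplaneSection.nontransverseLocus (HyperplaneSection.formOver K f)
            (HyperplaneSection.vecOver K a) =
          ProjectiveSpectrum.zeroLocus (MvPolynomial.homogeneousSubmodule (Fin n) K)
            (HyperplaneSection.nontransverseIdeal (HyperplaneSection.formOver K f)
              (HyperplaneSection.vecOver K a) : Set (MvPolynomial (Fin n) K)) ∧
        (HyperplaneSection.nontransverseLocus (HyperplaneSection.formOver K f)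
            (HyperplaneSection.vecOver K a) = ∅ ∨
          topologicalKrullDim (HyperplaneSection.nontransverseLocus
            (HyperplaneSection.formOver K f) (HyperplaneSection.vecOver K a)) = 0) ∧
        ∃ D : ℕ, HyperplaneSection.HasDegree (HyperplaneSection.nontransverseIdeal
            (HyperplaneSection.formOver K f) (HyperplaneSection.vecOver K a)) D ∧ D ≤ C) ∧
      (HyperplaneSection.transversePoints (HyperplaneSection.formOver (ZMod p) f)
        (HyperplaneSection.vecOver (ZMod p) a)).ncard ≤ C * p ^ (n - 3) ∧
      (HyperplaneSection.nontransversePoints (HyperplaneSection.formOver (ZMod p) f)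
        (HyperplaneSection.vecOver (ZMod p) a)).ncard ≤ C := by
  obtain ⟨N, hN⟩ := HyperplaneSection.exists_uniform_X_pow_mem hsmooth
  refine ⟨HyperplaneSection.monomialCount n (n * N + (d - 1)) + 2 * d, ?_⟩
  intro a p _ hp
  have hpf : p ∉ HyperplaneSection.badPrimes f := fun h => hp (Or.inl h)
  obtain ⟨j, hj⟩ : ∃ j, ¬ (p : ℤ) ∣ a j := by
    by_contra! h
    exact hp (Or.inr ⟨Fact.out, h⟩)
  have hd1 : 0 < d - 1 := by omega
  have haj : ∀ (K : Type) [Field K], (CharZero K ∨ CharP K p) →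
      HyperplaneSection.vecOver K a j ≠ 0 := by
    rintro K _ (hK | hK) h
    · exact hj ((Int.cast_eq_zero.1 h) ▸ dvd_zero _)
    · exact hj ((CharP.intCast_eq_zero_iff K p _).1 h)
  have hF : ∀ (K : Type) [Field K], (HyperplaneSection.formOver K f).IsHomogeneous d :=
    fun K _ => hf.map _
  have hI := fun (K : Type) [Field K] =>
    HyperplaneSection.nontransverseIdeal_isHomogeneous (hF K) (HyperplaneSection.vecOver K a)
  have hX : ∀ (K : Type) [Field K], (CharZero K ∨ CharP K p) → ∀ i, X i ^ N ∈
      HyperplaneSection.nontransverseIdeal (HyperplaneSection.formOver K f)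
        (HyperplaneSection.vecOver K a) ⊔
          Ideal.span {pderiv j (HyperplaneSection.formOver K f)} := fun K _ hK i =>
    HyperplaneSection.jacobianIdeal_le_nontransverseIdeal_sup _ (haj K hK) (hN p hpf K hK i)
  refine ⟨fun K _ _ => ?_, ?_, ?_⟩
  · have hK : CharZero K ∨ CharP K p := HyperplaneSection.charZero_or_charP_of_padicInt_algebra p K
    refine ⟨hI K, HyperplaneSection.nontransverseLocus_eq_zeroLocus _ _, ?_, ?_⟩
    · rw [HyperplaneSection.nontransverseLocus_eq_zeroLocus]
      exact (Set.eq_empty_or_nonempty _).imp_right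
        (HyperplaneSection.topologicalKrullDim_zeroLocus (hI K) hd1 (hF K).pderiv (hX K hK))
    · obtain ⟨D, hD, hle⟩ :=
        HyperplaneSection.exists_hasDegree_le (hI K) hd1 (hF K).pderiv (hX K hK)
      exact ⟨D, hD, le_add_right hle⟩
  · refine (HyperplaneSection.ncard_transversePoints_le (hF (ZMod p))
      (haj (ZMod p) (Or.inr inferInstance)) hn).trans ?_
    rw [ZMod.card]
    exact Nat.mul_le_mul_right _ (Nat.le_add_left _ _)
  · refine (HyperplaneSection.ncard_nontransversePoints_le fun m =>
      HyperplaneSection.hilbertFunction_le_monomialCount (hI (ZMod p)) hd1 (hF (ZMod p)).pderiv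
        (hX (ZMod p) (Or.inr inferInstance)) m).trans (Nat.le_add_right _ _)
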